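/- Let $(\Omega,P)$ be a probability space, $X$ a random element of a measurable space $\mathcal X$, and $\|f\|_{L_2}=(\mathbb E f(X)^2)^{1/2}$. Let $F=\{f_1,\dots,f_M\}$ be a finite family of real functions on $\mathcal X$ with $\|f_j\|_{L_2}<\infty$, and let $\mathrm{span}(F)$ be its linear span. Assume that there are constants $\kappa_0>0$ and $\beta_0>0$ such that $$P\{|f(X)|\ge \kappa_0\|f\|_{L_2}\}\ge \beta_0\qquad\text{for every } f\in\mathrm{span}(F).$$ Consider the regression model $Y=f^*(X)+\zeta$, where $f^*\in\mathrm{span}(F)$ and $\zeta\in L_2$ is a mean-zero real random variable independent of $X$, and let $\sigma\in\mathbb R$ satisfy $\mathbb E\zeta^2\le\sigma^2$. Let $(X_i,Y_i)_{i=1}^N$ be independent copies of $(X,Y)$, with $N\ge (400)^2M/\beta_0^2$, and let $\hat f^{ERM}$ be an empirical risk minimizer in $\mathrm{span}(F)$, that is, $$\hat f^{ERM}\in\operatorname*{argmin}_{f\in\mathrm{span}(F)}\frac1N\sum_{i=1}^N\big(Y_i-f(X_i)\big)^2.$$ Then for every $x>0$, with probability at least $1-\exp(-\beta_0^2N/4)-1/x$,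 $$\|\hat f^{ERM}-f^*\|_{L_2}^2\le\Big(\frac{16}{\beta_0\kappa_0^2}\Big)^2\frac{\sigma^2Mx}{N}$$ (that is, there is an event of at least this probability on which the bound holds for every choice of the empirical risk minimizer). -/

import Mathlib

open MeasureTheory ProbabilityTheory

noncomputable section

/-- The span of a dictionary `F = {f₁, …, f_M}`, as a space of real functions on `𝒳`. -/
def dictSpan {𝒳 : Type*} {M : ℕ} (F : Fin M → 𝒳 → ℝ) : Submodule ℝ (𝒳 → ℝ) :=
  Submodule.span ℝ (Set.range F)

/-- The norm `‖f‖_{L₂} = (E f(X)²)^{1/2}` determined by the distribution of the design `X`. -/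
def designL2Norm {Ω 𝒳 : Type*} [MeasurableSpace Ω] (P : Measure Ω) (X : Ω → 𝒳)
    (f : 𝒳 → ℝ) : ℝ :=
  Real.sqrt (∫ ω, (f (X ω)) ^ 2 ∂P)

/-- The small-ball condition on a class `V` with constants `κ₀` and `β₀`:
`P(|f(X)| ≥ κ₀ ‖f‖_{L₂}) ≥ β₀` for every `f ∈ V`. -/
def SmallBall {Ω 𝒳 : Type*} [MeasurableSpace Ω] (P : Measure Ω) (X : Ω → 𝒳)
    (V : Submodule ℝ (𝒳 → ℝ)) (κ₀ β₀ : ℝ) : Prop :=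
  ∀ f ∈ V, β₀ ≤ P.real {ω | κ₀ * designL2Norm P X f ≤ |f (X ω)|}

/-- The empirical squared risk `R_N(f) = (1/N) ∑ᵢ (yᵢ - f(xᵢ))²`. -/
def empiricalRisk {𝒳 : Type*} {N : ℕ} (x : Fin N → 𝒳) (y : Fin N → ℝ) (f : 𝒳 → ℝ) : ℝ :=
  (1 / (N : ℝ)) * ∑ i, (y i - f (x i)) ^ 2

/-- `f` is an empirical risk minimizer in `V` for the sample `(xᵢ, yᵢ)`, that is,
`f ∈ argmin_{g ∈ V} R_N(g)`. -/
def IsERM {𝒳 : Type*} {N : ℕ} (V : Submodule ℝ (𝒳 → ℝ)) (x : Fin N → 𝒳) (y : Fin N → ℝ)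
    (f : 𝒳 → ℝ) : Prop :=
  f ∈ V ∧ ∀ g ∈ V, empiricalRisk x y f ≤ empiricalRisk x y g

end

/-!
Write `h = f̂ - f*` and `ζᵢ = Yᵢ - f*(Xᵢ)`. Comparing the empirical risks of `f̂` and `f*` gives
`∑ᵢ h(Xᵢ)² ≤ 2 ∑ᵢ ζᵢ h(Xᵢ)`. The quadratic side is bounded below by the small-ball condition, made
uniform over the span, and the noise side is bounded above by a second-moment computation.

*Coordinates.* An `L²`-orthonormal family `e₁, …, e_m`, `m ≤ M`, with the same span as the dictionary
up to null sets (`exists_measurable_orthonormal_family`) turns functions of the span into vectors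
`c ∈ ℝᵐ`, with `h(Xᵢ) = ⟨c, Zᵢ⟩`, `Zᵢ = (e_k(Xᵢ))_k` and `‖h‖_{L₂} = |c|`. Here `m < M` is allowed, so
the dictionary may be linearly dependent.

*Quadratic side* (`exists_uniform_small_ball_event`). Outside an event of probability at most
`exp (-β₀² N / 4)`, every `c` satisfies `|⟨c, Zᵢ⟩| ≥ κ₀ |c|` for at least `β₀ N / 8` indices `i`. The
sets `{v | |⟨c, v⟩| ≥ κ₀ |c|}` are unions of two half-spaces, so by Sauer–Shelah they leave at most
`exp (8 √(N M))` traces on `2 N` points (`card_slab_traces_le_exp`). If one of them is hit fewer than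
`β₀ N / 8` times, then an independent ghost sample hits it at least `9 β₀ N / 10` times with
probability at least `1 / 2`. Swapping the two samples pairwise at random shows that such a
discrepancy is exponentially unlikely for each trace (`sum_swap_indicator_le`), and a union bound over
the traces follows. A multiplicative deviation bound is needed here: the exponent is of order `β₀ N`,
and `N ≥ 400² M / β₀²` makes it exceed `√(N M)` by a large factor, so no logarithm of `N / M` is lost.
Only rational `c` have to be considered, which makes the exceptional event measurable.

*Noise side* (`integral_noise_sq_le`). By Cauchy–Schwarz, `|∑ᵢ ζᵢ ⟨c, Zᵢ⟩| ≤ |c| √W` with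
`W = |∑ᵢ ζᵢ Zᵢ|²`, and `E W ≤ N m σ²` by independence and orthonormality. Markov's inequality gives
`W ≤ N m σ² x` with probability at least `1 - 1 / x`.

On both events `κ₀² |c|² β₀ N / 8 ≤ 2 |c| √W`, which rearranges to the risk bound
(`dotProduct_self_le_of_sum_sq_le`).
-/

/-! ### Shatter coefficients of half-spaces and slabs -/

/-- A weighted form of the Sauer–Shelah bound: every shattered set `s` contributes
`x ^ (#s - d) ≥ 1`, and `∑ₛ x ^ #s = (1 + x) ^ n` over all `s`. -/
theorem card_mul_pow_le_of_shatters {ι : Type*} [Fintype ι] [DecidableEq ι]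
    (𝒜 : Finset (Finset ι)) (d : ℕ) (h : ∀ s, 𝒜.Shatters s → s.card ≤ d)
    (x : ℝ) (hx0 : 0 ≤ x) (hx1 : x ≤ 1) :
    (𝒜.card : ℝ) * x ^ d ≤ (1 + x) ^ Fintype.card ι := by
  calc (𝒜.card : ℝ) * x ^ d ≤ (𝒜.shatterer.card : ℝ) * x ^ d := by
        have := Finset.card_le_card_shatterer 𝒜
        gcongr ?_ * _
        exact_mod_cast this
    _ = ∑ _s ∈ 𝒜.shatterer, x ^ d := by simp
    _ ≤ ∑ s ∈ 𝒜.shatterer, x ^ s.card := by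
        refine Finset.sum_le_sum fun s hs => ?_
        exact pow_le_pow_of_le_one hx0 hx1 (h s (Finset.mem_shatterer.1 hs))
    _ ≤ ∑ s : Finset ι, x ^ s.card :=
        Finset.sum_le_sum_of_subset_of_nonneg (Finset.subset_univ _) fun _ _ _ => by positivity
    _ = (1 + x) ^ Fintype.card ι := by
        rw [add_comm, ← Fintype.sum_pow_mul_eq_add_pow]
        simp

open Classical in
/-- The traces on the points `z i` of the closed half-spaces `{v | θ ≤ c ⬝ᵥ v}` of `ℝᵐ`. -/
noncomputable def halfspaceTraces {ι : Type*} [Fintype ι] {m : ℕ} (z : ι → Fin m → ℝ) :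
    Finset (Finset ι) :=
  Finset.univ.filter fun U => ∃ (c : Fin m → ℝ) (θ : ℝ), ∀ i, i ∈ U ↔ θ ≤ c ⬝ᵥ z i

/-- Half-spaces of `ℝᵐ` shatter at most `m + 1` points: a linear relation `∑ gᵢ (zᵢ, 1) = 0`
with some `gᵢ < 0` prevents a half-space from selecting exactly the points with `gᵢ ≥ 0`. -/
theorem card_le_of_shatters_halfspaceTraces {ι : Type*} [Fintype ι] [DecidableEq ι] {m : ℕ}
    (z : ι → Fin m → ℝ) (s : Finset ι) (hs : (halfspaceTraces z).Shatters s) :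
    s.card ≤ m + 1 := by
  by_contra! hlt
  have hnot : ¬ LinearIndependent ℝ (fun i : s => ((z i, 1) : (Fin m → ℝ) × ℝ)) := by
    intro hli
    have := hli.fintype_card_le_finrank
    simp at this
    omega
  obtain ⟨g, hg, i₀, hi₀⟩ := Fintype.not_linearIndependent_iff.1 hnot
  obtain ⟨g, hg, i₀, hi₀⟩ : ∃ g : s → ℝ, ∑ i, g i • ((z i, 1) : (Fin m → ℝ) × ℝ) = 0 ∧
      ∃ i, g i < 0 := by
    rcases lt_or_gt_of_ne hi₀ with h | h
    · exact ⟨g, hg, i₀, h⟩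
    · refine ⟨-g, ?_, i₀, by simpa using h⟩
      simpa only [Pi.neg_apply, neg_smul, Finset.sum_neg_distrib, neg_eq_zero] using hg
  have h1 : ∑ i, g i • z i = 0 := by
    simpa [Prod.fst_sum] using congrArg Prod.fst hg
  have h2 : ∑ i, g i = 0 := by
    simpa [Prod.snd_sum] using congrArg Prod.snd hg
  obtain ⟨U, hU, hUs⟩ := hs (t := s.filter fun i => ∃ hi : i ∈ s, 0 ≤ g ⟨i, hi⟩)
    (Finset.filter_subset _ _)
  simp only [halfspaceTraces, Finset.mem_filter, Finset.mem_univ, true_and] at hU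
  obtain ⟨c, θ, hc⟩ := hU
  have hiff : ∀ i : s, θ ≤ c ⬝ᵥ z i ↔ 0 ≤ g i := by
    intro i
    have := Finset.ext_iff.1 hUs i
    simpa [hc] using this
  have hsum : ∑ i, g i * (c ⬝ᵥ z i - θ) = 0 := by
    have : ∑ i, g i * (c ⬝ᵥ z i) = 0 := by
      have := congrArg (fun v => c ⬝ᵥ v) h1
      simpa [dotProduct_sum, dotProduct_smul] using this
    simp only [mul_sub, Finset.sum_sub_distrib, this, ← Finset.sum_mul, h2]
    simp
  have hpos : 0 < ∑ i, g i * (c ⬝ᵥ z i - θ) := by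
    refine Finset.sum_pos' (fun i _ => ?_) ⟨i₀, Finset.mem_univ _, ?_⟩
    · by_cases h : 0 ≤ g i
      · exact mul_nonneg h (sub_nonneg.2 ((hiff i).2 h))
      · have h' : c ⬝ᵥ z i < θ := not_le.1 fun hh => h ((hiff i).1 hh)
        exact mul_nonneg_of_nonpos_of_nonpos (not_le.1 h).le (by linarith)
    · have h' : c ⬝ᵥ z i₀ < θ := not_le.1 fun hh => (not_le.2 hi₀) ((hiff i₀).1 hh)
      exact mul_pos_of_neg_of_neg hi₀ (by linarith)
  exact hpos.ne' hsum

/-- The complement of a slab is a union of two half-spaces, so a family of complements of slabs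
`{v | θ t ≤ |c t ⬝ᵥ v|}` has at most `#(halfspaceTraces z) ^ 2` traces. -/
theorem card_slab_traces_le {ι T : Type*} [Fintype ι] {m : ℕ} (c : T → Fin m → ℝ) (θ : T → ℝ)
    (z : ι → Fin m → ℝ) (𝒢 : Finset (Finset ι))
    (h𝒢 : ∀ U ∈ 𝒢, ∃ t, ∀ i, i ∈ U ↔ θ t ≤ |c t ⬝ᵥ z i|) :
    𝒢.card ≤ (halfspaceTraces z).card ^ 2 := by
  classical
  have hsub : 𝒢 ⊆ Finset.image₂ (· ∪ ·) (halfspaceTraces z) (halfspaceTraces z) := by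
    intro U hU
    obtain ⟨t, ht⟩ := h𝒢 U hU
    refine Finset.mem_image₂.2 ⟨Finset.univ.filter fun i => θ t ≤ c t ⬝ᵥ z i, ?_,
      Finset.univ.filter fun i => θ t ≤ (-c t) ⬝ᵥ z i, ?_, ?_⟩
    · simpa [halfspaceTraces] using ⟨c t, θ t, fun i => Iff.rfl⟩
    · simp only [halfspaceTraces, Finset.mem_filter, Finset.mem_univ, true_and]
      exact ⟨-c t, θ t, fun i => Iff.rfl⟩
    · ext i
      simp [ht, le_abs, neg_dotProduct]
  calc 𝒢.card ≤ _ := Finset.card_le_card hsub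
    _ ≤ _ := Finset.card_image₂_le _ _ _
    _ = _ := by ring

/-- The choice `x = √(M / N)` in the weighted Sauer–Shelah bound, for `2 N` points in `ℝᵐ`. -/
theorem card_slab_traces_le_exp {T : Type*} {m M N : ℕ} (hm : m ≤ M) (hM : 1 ≤ M) (hMN : M ≤ N)
    (c : T → Fin m → ℝ) (θ : T → ℝ) (z : Fin N × Bool → Fin m → ℝ)
    (𝒢 : Finset (Finset (Fin N × Bool)))
    (h𝒢 : ∀ U ∈ 𝒢, ∃ t, ∀ i, i ∈ U ↔ θ t ≤ |c t ⬝ᵥ z i|) :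
    (𝒢.card : ℝ) ≤ Real.exp (8 * √(N * M)) := by
  classical
  have hM0 : (0 : ℝ) < M := by exact_mod_cast hM
  have hN0 : (0 : ℝ) < N := by exact_mod_cast (by omega : 0 < N)
  set y : ℝ := √M
  set w : ℝ := √N
  have hy : 0 < y := Real.sqrt_pos.2 hM0
  have hw : 0 < w := Real.sqrt_pos.2 hN0
  have hyy : y * y = M := Real.mul_self_sqrt hM0.le
  have hww : w * w = N := Real.mul_self_sqrt hN0.le
  have hyw : y ≤ w := Real.sqrt_le_sqrt (by exact_mod_cast hMN)
  have hsq : √((N : ℝ) * M) = w * y := Real.sqrt_mul hN0.le _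
  have key := card_mul_pow_le_of_shatters (halfspaceTraces z) (2 * M)
    (fun s hs => (card_le_of_shatters_halfspaceTraces z s hs).trans (by omega)) (y / w)
    (by positivity) ((div_le_one hw).2 hyw)
  have h1 : (1 + y / w) ^ Fintype.card (Fin N × Bool) ≤ Real.exp (2 * (w * y)) := by
    calc (1 + y / w) ^ Fintype.card (Fin N × Bool)
        ≤ Real.exp (y / w) ^ Fintype.card (Fin N × Bool) := by
          gcongr
          linarith [Real.add_one_le_exp (y / w)]
      _ = Real.exp (2 * (w * y)) := by
          rw [← Real.exp_nat_mul]
          congr 1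
          simp only [Fintype.card_prod, Fintype.card_fin, Fintype.card_bool]
          push_cast
          rw [← hww]
          field_simp
  have h2 : Real.exp (-(2 * (w * y))) ≤ (y / w) ^ (2 * M) := by
    calc Real.exp (-(2 * (w * y))) = Real.exp (-(w / y)) ^ (2 * M) := by
          rw [← Real.exp_nat_mul]
          congr 1
          push_cast
          rw [← hyy]
          field_simp
      _ ≤ (y / w) ^ (2 * M) := by
          gcongr
          rw [Real.exp_neg, ← inv_div w y]
          gcongr
          linarith [Real.add_one_le_exp (w / y)]
  have h3 : ((halfspaceTraces z).card : ℝ) ≤ Real.exp (4 * (w * y)) := by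
    have h4 : ((halfspaceTraces z).card : ℝ) * Real.exp (-(2 * (w * y)))
        ≤ Real.exp (2 * (w * y)) :=
      (mul_le_mul_of_nonneg_left h2 (Nat.cast_nonneg _)).trans (key.trans h1)
    rw [Real.exp_neg, ← div_eq_mul_inv, div_le_iff₀ (Real.exp_pos _), ← Real.exp_add] at h4
    exact h4.trans_eq (by ring_nf)
  calc (𝒢.card : ℝ) ≤ ((halfspaceTraces z).card : ℝ) ^ 2 := by
        exact_mod_cast card_slab_traces_le c θ z 𝒢 h𝒢
    _ ≤ Real.exp (4 * (w * y)) ^ 2 := by gcongr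
    _ = Real.exp (8 * √(N * M)) := by
        rw [← Real.exp_nat_mul, hsq]
        congr 1
        push_cast
        ring

/-! ### Symmetrization by random swaps -/

/-- The number of points of the sample `s` that fall into `A`, as a real number. -/
noncomputable def hitCount {S : Type*} {N : ℕ} (A : Set S) (s : Fin N → S) : ℝ :=
  ∑ i, A.indicator 1 (s i)

theorem measurable_hitCount {S : Type*} [MeasurableSpace S] {N : ℕ} {A : Set S}
    (hA : MeasurableSet A) : Measurable (hitCount A : (Fin N → S) → ℝ) := by
  unfold hitCount
  exact Finset.measurable_sum _ fun i _ =>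
    ((measurable_const (a := (1 : ℝ))).indicator hA).comp (measurable_pi_apply i)

open Classical in
/-- For a fixed set `U` of indices, a uniformly random swap `ε` of the two halves puts few points
of `U` into the first half and many into the second with exponentially small probability. The
weights `exp (-#first + (12 / 25) #second)` average to at most `1` over the two positions of each
pair, since `exp (-1) + exp (12 / 25) ≤ 2`. -/
theorem sum_swap_indicator_le {N : ℕ} (U : Set (Fin N × Bool)) (a b : ℝ) :
    (∑ ε : Fin N → Bool,
      if hitCount U (fun i => (i, ε i)) ≤ a ∧ b ≤ hitCount U (fun i => (i, !ε i))
      then (1 : ℝ) else 0) ≤ 2 ^ N * Real.exp (a - 12 / 25 * b) := by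
  set u : Fin N × Bool → ℝ := U.indicator 1
  set w : Fin N → Bool → ℝ := fun i e => Real.exp (-u (i, e) + 12 / 25 * u (i, !e))
  have hw : ∀ i, w i true + w i false ≤ 2 := by
    intro i
    have e1 : Real.exp (-1) ≤ 0.3678794413 := by
      have := Real.exp_neg_one_lt_d9
      linarith
    have e2 : Real.exp (12 / 25) ≤ 1.63 := by
      have := Real.exp_bound' (x := 12 / 25) (by norm_num) (by norm_num) (n := 4) (by norm_num)
      refine this.trans ?_
      norm_num [Finset.sum_range_succ, Nat.factorial]
    have e3 : Real.exp (-(13 / 25)) ≤ 1 := Real.exp_le_one_iff.2 (by norm_num)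
    have hu : ∀ q, u q = 0 ∨ u q = 1 := fun q => by
      by_cases hq : q ∈ U <;> simp [u, hq]
    simp only [w, Bool.not_true, Bool.not_false]
    rcases hu (i, true) with h | h <;> rcases hu (i, false) with h' | h' <;> rw [h, h'] <;>
      norm_num at e1 e2 ⊢ <;> linarith
  calc _ ≤ ∑ ε : Fin N → Bool, Real.exp (a - 12 / 25 * b) * ∏ i, w i (ε i) := by
        refine Finset.sum_le_sum fun ε _ => ?_
        rw [← Real.exp_sum, ← Real.exp_add]
        split_ifs with h
        · obtain ⟨h1, h2⟩ := h
          rw [Real.one_le_exp_iff]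
          simp only [Finset.sum_add_distrib, Finset.sum_neg_distrib, ← Finset.mul_sum]
          simp only [hitCount] at h1 h2
          linarith
        · positivity
    _ = Real.exp (a - 12 / 25 * b) * ∏ i, (w i true + w i false) := by
        rw [← Finset.mul_sum]
        congr 1
        have := Finset.prod_univ_sum (fun _ : Fin N => (Finset.univ : Finset Bool)) w
        rw [Fintype.piFinset_univ] at this
        rw [← this]
        simp
    _ ≤ Real.exp (a - 12 / 25 * b) * ∏ _i : Fin N, (2 : ℝ) := by
        refine mul_le_mul_of_nonneg_left ?_ (Real.exp_pos _).le
        exact Finset.prod_le_prod (fun i _ => by positivity) fun i _ => hw i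
    _ = 2 ^ N * Real.exp (a - 12 / 25 * b) := by simp [mul_comm]

/-- Exchange of the two components of the `i`-th pair for every `i` with `ε i = true`. -/
def swapPairs {S : Type*} {N : ℕ} (ε : Fin N → Bool) (p : Fin N → S × S) : Fin N → S × S :=
  fun i => if ε i then (p i).swap else p i

theorem measurePreserving_swapPairs {S : Type*} [MeasurableSpace S] (μ : Measure S)
    [IsProbabilityMeasure μ] {N : ℕ} (ε : Fin N → Bool) :
    MeasurePreserving (swapPairs ε) (Measure.pi fun _ : Fin N => μ.prod μ)
      (Measure.pi fun _ : Fin N => μ.prod μ) := by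
  refine measurePreserving_pi (fun _ => μ.prod μ) (fun _ => μ.prod μ)
    (f := fun i q => if ε i then q.swap else q) fun i => ?_
  cases ε i
  · exact MeasurePreserving.id _
  · simpa using Measure.measurePreserving_swap

/-- If the sets `A t` leave at most `G` traces on any `2 N` points, then it is unlikely that some
`A t` is hit rarely by one sample and often by an independent one. -/
theorem measure_pair_hitCount_le {S T : Type*} [MeasurableSpace S] [Countable T]
    (μ : Measure S) [IsProbabilityMeasure μ] {N : ℕ} (A : T → Set S)
    (hA : ∀ t, MeasurableSet (A t)) (G : ℝ)
    (hG : ∀ (z : Fin N × Bool → S) (𝒢 : Finset (Finset (Fin N × Bool))),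
      (∀ U ∈ 𝒢, ∃ t, ∀ q, q ∈ U ↔ z q ∈ A t) → (𝒢.card : ℝ) ≤ G) (a b : ℝ) :
    (Measure.pi fun _ : Fin N => μ.prod μ)
      {p | ∃ t, hitCount (A t) (fun i => (p i).1) ≤ a ∧ b ≤ hitCount (A t) (fun i => (p i).2)} ≤
      ENNReal.ofReal (G * Real.exp (a - 12 / 25 * b)) := by
  classical
  set ν := Measure.pi fun _ : Fin N => μ.prod μ
  set C : Set (Fin N → S × S) :=
    {p | ∃ t, hitCount (A t) (fun i => (p i).1) ≤ a ∧ b ≤ hitCount (A t) (fun i => (p i).2)}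
  have hC : MeasurableSet C := by
    have : C = ⋃ t, ({p | hitCount (A t) (fun i => (p i).1) ≤ a} ∩
        {p | b ≤ hitCount (A t) (fun i => (p i).2)}) := by
      ext p
      simp [C]
    rw [this]
    refine MeasurableSet.iUnion fun t => MeasurableSet.inter ?_ ?_
    · exact measurableSet_le ((measurable_hitCount (hA t)).comp (by fun_prop)) measurable_const
    · exact measurableSet_le measurable_const ((measurable_hitCount (hA t)).comp (by fun_prop))
  -- the average over the swaps is bounded at every point, by a union bound over the traces
  have hpt : ∀ p, (∑ ε : Fin N → Bool, (C.indicator 1 (swapPairs ε p) : ℝ)) ≤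
      2 ^ N * (G * Real.exp (a - 12 / 25 * b)) := by
    intro p
    set z : Fin N × Bool → S := fun q => if q.2 then (p q.1).2 else (p q.1).1
    set 𝒢 : Finset (Finset (Fin N × Bool)) :=
      Finset.univ.filter fun U => ∃ t, ∀ q, q ∈ U ↔ z q ∈ A t
    have hcard : (𝒢.card : ℝ) ≤ G := hG z 𝒢 fun U hU => by simpa [𝒢] using hU
    have hle : ∀ ε : Fin N → Bool, (C.indicator 1 (swapPairs ε p) : ℝ) ≤
        ∑ U ∈ 𝒢, if hitCount (U : Set (Fin N × Bool)) (fun i => (i, ε i)) ≤ a ∧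
          b ≤ hitCount (U : Set (Fin N × Bool)) (fun i => (i, !ε i)) then (1 : ℝ) else 0 := by
      intro ε
      by_cases hmem : swapPairs ε p ∈ C
      · obtain ⟨t, ht1, ht2⟩ := hmem
        set U : Finset (Fin N × Bool) := Finset.univ.filter fun q => z q ∈ A t
        have hU : U ∈ 𝒢 := by
          simp only [𝒢, Finset.mem_filter, Finset.mem_univ, true_and]
          exact ⟨t, fun q => by simp [U]⟩
        have e1 : hitCount (U : Set (Fin N × Bool)) (fun i => (i, ε i)) =
            hitCount (A t) (fun i => (swapPairs ε p i).1) := by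
          unfold hitCount
          refine Finset.sum_congr rfl fun i _ => ?_
          cases h : ε i <;> simp [Set.indicator, U, z, swapPairs, h]
        have e2 : hitCount (U : Set (Fin N × Bool)) (fun i => (i, !ε i)) =
            hitCount (A t) (fun i => (swapPairs ε p i).2) := by
          unfold hitCount
          refine Finset.sum_congr rfl fun i _ => ?_
          cases h : ε i <;> simp [Set.indicator, U, z, swapPairs, h]
        rw [Set.indicator_of_mem (show swapPairs ε p ∈ C from ⟨t, ht1, ht2⟩)]
        refine le_trans ?_ (Finset.single_le_sum (fun V _ => ?_) hU)
        · rw [if_pos ⟨e1.trans_le ht1, ht2.trans_eq e2.symm⟩]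
          simp
        · split_ifs <;> norm_num
      · rw [Set.indicator_of_notMem hmem]
        exact Finset.sum_nonneg fun V _ => by split_ifs <;> norm_num
    calc _ ≤ _ := Finset.sum_le_sum fun ε _ => hle ε
      _ = _ := Finset.sum_comm
      _ ≤ ∑ _U ∈ 𝒢, 2 ^ N * Real.exp (a - 12 / 25 * b) :=
          Finset.sum_le_sum fun U _ => sum_swap_indicator_le (U : Set (Fin N × Bool)) a b
      _ = 𝒢.card * (2 ^ N * Real.exp (a - 12 / 25 * b)) := by simp
      _ ≤ G * (2 ^ N * Real.exp (a - 12 / 25 * b)) := by gcongr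
      _ = _ := by ring
  have hinv : ∀ ε : Fin N → Bool, ν.real C = ∫ p, (C.indicator 1 (swapPairs ε p) : ℝ) ∂ν := by
    intro ε
    have h1 := (measurePreserving_swapPairs μ ε).measureReal_preimage hC.nullMeasurableSet
    rw [← h1, ← integral_indicator_one ((measurePreserving_swapPairs μ ε).measurable hC)]
    rfl
  have hint : ∀ ε : Fin N → Bool,
      Integrable (fun p => (C.indicator 1 (swapPairs ε p) : ℝ)) ν := by
    intro ε
    have : Integrable (C.indicator (1 : (Fin N → S × S) → ℝ)) ν :=
      (integrable_const (1 : ℝ)).indicator hC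
    exact (measurePreserving_swapPairs μ ε).integrable_comp_of_integrable this
  have hmain : (2 : ℝ) ^ N * ν.real C ≤ 2 ^ N * (G * Real.exp (a - 12 / 25 * b)) := by
    calc (2 : ℝ) ^ N * ν.real C = ∑ _ε : Fin N → Bool, ν.real C := by simp
      _ = ∑ ε : Fin N → Bool, ∫ p, (C.indicator 1 (swapPairs ε p) : ℝ) ∂ν :=
          Finset.sum_congr rfl fun ε _ => hinv ε
      _ = ∫ p, ∑ ε : Fin N → Bool, (C.indicator 1 (swapPairs ε p) : ℝ) ∂ν :=
          (integral_finsetSum _ fun ε _ => hint ε).symm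
      _ ≤ ∫ _p, 2 ^ N * (G * Real.exp (a - 12 / 25 * b)) ∂ν :=
          integral_mono (integrable_finsetSum _ fun ε _ => hint ε) (integrable_const _) hpt
      _ = _ := by simp
  have := le_of_mul_le_mul_left hmain (by positivity)
  rw [← ofReal_measureReal]
  exact ENNReal.ofReal_le_ofReal this

/-- A lower-tail Chernoff bound for the number of hits of a set of measure at least `β`. -/
theorem measure_hitCount_lt_le {S : Type*} [MeasurableSpace S] (μ : Measure S)
    [IsProbabilityMeasure μ] (N : ℕ) (A : Set S) (hA : MeasurableSet A) (β : ℝ)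
    (hβ : β ≤ μ.real A) :
    (Measure.pi fun _ : Fin N => μ).real {s | hitCount A s < 9 / 10 * (β * N)} ≤
      Real.exp (-(β * N / 200)) := by
  set ν := Measure.pi fun _ : Fin N => μ
  have hprod : ∀ s : Fin N → S, Real.exp (-(1 / 10) * hitCount A s) =
      ∏ i, Real.exp (-(1 / 10) * A.indicator 1 (s i)) := fun s => by
    rw [← Real.exp_sum, hitCount, Finset.mul_sum]
  have hone : ∫ v, Real.exp (-(1 / 10) * A.indicator 1 v) ∂μ ≤
      Real.exp (-(19 / 200) * β) := by
    have h1 : ∀ v, Real.exp (-(1 / 10) * A.indicator (1 : S → ℝ) v) ≤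
        1 - 19 / 200 * A.indicator (1 : S → ℝ) v := by
      intro v
      by_cases hv : v ∈ A
      · have h2 := Real.quadratic_le_exp_of_nonneg (x := 1 / 10) (by norm_num)
        simp only [hv, Set.indicator_of_mem, Pi.one_apply, mul_one]
        rw [Real.exp_neg]
        refine (inv_anti₀ (by norm_num) h2).trans ?_
        norm_num
      · simp [hv]
    have hi : Integrable (fun v => A.indicator (1 : S → ℝ) v) μ :=
      (integrable_const (1 : ℝ)).indicator hA
    have hi2 : Integrable (fun v => 1 - 19 / 200 * A.indicator (1 : S → ℝ) v) μ :=
      (integrable_const _).sub (hi.const_mul _)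
    calc ∫ v, Real.exp (-(1 / 10) * A.indicator 1 v) ∂μ
        ≤ ∫ v, (1 - 19 / 200 * A.indicator (1 : S → ℝ) v) ∂μ :=
          integral_mono_of_nonneg (ae_of_all _ fun _ => (Real.exp_pos _).le) hi2 (ae_of_all _ h1)
      _ = 1 - 19 / 200 * μ.real A := by
          rw [integral_sub (integrable_const _) (hi.const_mul _), integral_const_mul,
            integral_indicator_one hA]
          simp
      _ ≤ Real.exp (-(19 / 200) * β) := by
          linarith [Real.add_one_le_exp (-(19 / 200) * β)]
  have hint : Integrable (fun s => Real.exp (-(1 / 10) * hitCount A s)) ν := by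
    refine Integrable.of_bound (C := 1)
      ((measurable_hitCount hA).const_mul _).exp.aestronglyMeasurable (ae_of_all _ fun s => ?_)
    rw [Real.norm_eq_abs, abs_of_pos (Real.exp_pos _), Real.exp_le_one_iff]
    have : 0 ≤ hitCount A s :=
      Finset.sum_nonneg fun i _ => Set.indicator_nonneg (fun _ _ => by simp) _
    linarith
  have hE : ∫ s, Real.exp (-(1 / 10) * hitCount A s) ∂ν ≤ Real.exp (-(19 / 200) * β * N) := by
    simp_rw [hprod]
    rw [integral_fintype_prod_eq_pow (fun v => Real.exp (-(1 / 10) * A.indicator (1 : S → ℝ) v)),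
      Fintype.card_fin, mul_comm _ (N : ℝ), Real.exp_nat_mul]
    exact pow_le_pow_left₀ (integral_nonneg fun _ => (Real.exp_pos _).le) hone N
  have hmk := mul_meas_ge_le_integral_of_nonneg
    (ae_of_all ν fun s => (Real.exp_pos (-(1 / 10) * hitCount A s)).le) hint
    (Real.exp (-(1 / 10) * (9 / 10 * (β * N))))
  have hsub : ν.real {s | hitCount A s < 9 / 10 * (β * N)} ≤
      ν.real {s | Real.exp (-(1 / 10) * (9 / 10 * (β * N))) ≤
        Real.exp (-(1 / 10) * hitCount A s)} := by
    refine measureReal_mono fun s hs => ?_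
    simp only [Set.mem_ofPred_eq] at hs ⊢
    exact Real.exp_le_exp.2 (by linarith)
  have h3 := (mul_le_mul_of_nonneg_left hsub (Real.exp_pos _).le).trans (hmk.trans hE)
  rw [← le_div_iff₀' (Real.exp_pos _), ← Real.exp_sub] at h3
  exact h3.trans_eq (by ring_nf)

/-! ### A uniform lower bound for hit counts -/

/-- Comparison with a ghost sample: if every `A t` is hit at least `b` times with probability at
least `1 / 2`, then a sample that hits some `A t` at most `a` times is as unlikely, up to a factor
`2`, as the discrepancy between two independent samples. -/
theorem measure_exists_hitCount_le {S T : Type*} [MeasurableSpace S] [Countable T]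
    (μ : Measure S) [IsProbabilityMeasure μ] {N : ℕ} (A : T → Set S)
    (hA : ∀ t, MeasurableSet (A t)) (G : ℝ) (hG0 : 0 ≤ G)
    (hG : ∀ (z : Fin N × Bool → S) (𝒢 : Finset (Finset (Fin N × Bool))),
      (∀ U ∈ 𝒢, ∃ t, ∀ q, q ∈ U ↔ z q ∈ A t) → (𝒢.card : ℝ) ≤ G) (a b : ℝ)
    (hb : ∀ t, (Measure.pi fun _ : Fin N => μ).real {s | hitCount (A t) s < b} ≤ 1 / 2) :
    (Measure.pi fun _ : Fin N => μ).real {s | ∃ t, hitCount (A t) s ≤ a} ≤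
      2 * (G * Real.exp (a - 12 / 25 * b)) := by
  set ν := Measure.pi fun _ : Fin N => μ
  set B : Set (Fin N → S) := {s | ∃ t, hitCount (A t) s ≤ a}
  set D : Set ((Fin N → S) × (Fin N → S)) :=
    {q | ∃ t, hitCount (A t) q.1 ≤ a ∧ b ≤ hitCount (A t) q.2}
  have hD : MeasurableSet D := by
    have : D = ⋃ t, ({q | hitCount (A t) q.1 ≤ a} ∩ {q | b ≤ hitCount (A t) q.2}) := by
      ext q
      simp [D]
    rw [this]
    refine MeasurableSet.iUnion fun t => MeasurableSet.inter ?_ ?_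
    · exact measurableSet_le ((measurable_hitCount (hA t)).comp measurable_fst) measurable_const
    · exact measurableSet_le measurable_const ((measurable_hitCount (hA t)).comp measurable_snd)
  have hB : MeasurableSet B := by
    have : B = ⋃ t, {s | hitCount (A t) s ≤ a} := by
      ext q
      simp [B]
    rw [this]
    exact MeasurableSet.iUnion fun t => measurableSet_le (measurable_hitCount (hA t))
      measurable_const
  have hpair : (ν.prod ν) D ≤ ENNReal.ofReal (G * Real.exp (a - 12 / 25 * b)) := by
    have hmp := measurePreserving_arrowProdEquivProdArrow S S (Fin N) (fun _ => μ) (fun _ => μ)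
    rw [← hmp.measure_preimage hD.nullMeasurableSet]
    exact measure_pair_hitCount_le μ A hA G hG a b
  have hhalf : ∀ t, (1 / 2 : ENNReal) ≤ ν {s | b ≤ hitCount (A t) s} := by
    intro t
    have hc : {s : Fin N → S | b ≤ hitCount (A t) s} = {s | hitCount (A t) s < b}ᶜ := by
      ext s
      simp
    have hm : MeasurableSet {s : Fin N → S | hitCount (A t) s < b} :=
      measurableSet_lt (measurable_hitCount (hA t)) measurable_const
    have h1 : (1 / 2 : ℝ) ≤ ν.real {s | b ≤ hitCount (A t) s} := by
      rw [hc, probReal_compl_eq_one_sub hm]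
      linarith [hb t]
    have h2 := ENNReal.ofReal_le_ofReal h1
    rw [ofReal_measureReal] at h2
    refine le_trans ?_ h2
    rw [ENNReal.ofReal_div_of_pos (by norm_num)]
    simp
  have hlow : (1 / 2 : ENNReal) * ν B ≤ (ν.prod ν) D := by
    rw [Measure.prod_apply hD, ← setLIntegral_const, ← lintegral_indicator hB]
    refine lintegral_mono fun s => ?_
    by_cases hs : s ∈ B
    · rw [Set.indicator_of_mem hs]
      obtain ⟨t, ht⟩ := hs
      exact (hhalf t).trans (measure_mono fun s' hs' => ⟨t, ht, hs'⟩)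
    · rw [Set.indicator_of_notMem hs]
      exact zero_le
  have h3 := ENNReal.toReal_mono ENNReal.ofReal_ne_top (hlow.trans hpair)
  rw [ENNReal.toReal_mul, ENNReal.toReal_ofReal (by positivity)] at h3
  simp only [one_div, ENNReal.toReal_inv, ENNReal.toReal_ofNat] at h3
  have h4 : ν.real B = (ν B).toReal := rfl
  rw [h4]
  linarith

/-- The growth `exp (8 √(N M))` of the trace family is absorbed by
the gain `exp (-(307 / 1000) β N)` of the symmetrization once `N ≥ 400² M / β²`. -/
theorem two_mul_exp_le_of_sample_size {M N : ℕ} {β : ℝ} (hM : 1 ≤ M) (hβ : 0 < β) (hβ1 : β ≤ 1)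
    (hN : (400 : ℝ) ^ 2 * M / β ^ 2 ≤ N) :
    2 * (Real.exp (8 * √(N * M)) *
      Real.exp (β * N / 8 - 12 / 25 * (9 / 10 * (β * N)))) ≤ Real.exp (-(β ^ 2 * N / 4)) := by
  have hM1 : (1 : ℝ) ≤ M := by exact_mod_cast hM
  have hN' : (400 : ℝ) ^ 2 * M ≤ N * β ^ 2 := (div_le_iff₀ (by positivity)).1 hN
  have hβN : 400 * √(N * M) ≤ β * N := by
    rw [← Real.sqrt_sq (by positivity : 0 ≤ β * N), ← Real.sqrt_sq (by norm_num : (0 : ℝ) ≤ 400),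
      ← Real.sqrt_mul (by positivity)]
    refine Real.sqrt_le_sqrt ?_
    nlinarith [mul_le_mul_of_nonneg_left hN' (Nat.cast_nonneg (α := ℝ) N)]
  have hNM : 1 ≤ √((N : ℝ) * M) := by
    rw [Real.one_le_sqrt]
    have : (1 : ℝ) ≤ N := by nlinarith [sq_nonneg β, Nat.cast_nonneg (α := ℝ) N]
    nlinarith
  have h2 : (2 : ℝ) ≤ Real.exp 1 := by linarith [Real.add_one_le_exp 1]
  calc _ ≤ Real.exp 1 * (Real.exp (8 * √(N * M)) *
        Real.exp (β * N / 8 - 12 / 25 * (9 / 10 * (β * N)))) := by gcongr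
    _ = Real.exp (1 + (8 * √(N * M) + (β * N / 8 - 12 / 25 * (9 / 10 * (β * N))))) := by
        rw [Real.exp_add, Real.exp_add]
    _ ≤ _ := by
        refine Real.exp_le_exp.2 ?_
        have : β ^ 2 * N ≤ β * N := by
          nlinarith [mul_nonneg hβ.le (Nat.cast_nonneg (α := ℝ) N)]
        linarith

/-- Under a small-ball condition for all linear functionals, with high probability every linear
functional is large on a fixed proportion of the sample, simultaneously. -/
theorem exists_uniform_small_ball_event {m M N : ℕ} (μ : Measure (Fin m → ℝ))
    [IsProbabilityMeasure μ] {κ β : ℝ} (hm : m ≤ M) (hM : 1 ≤ M) (hβ : 0 < β)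
    (hN : (400 : ℝ) ^ 2 * M / β ^ 2 ≤ N)
    (hsmall : ∀ c : Fin m → ℝ, β ≤ μ.real {v | κ * √(c ⬝ᵥ c) ≤ |c ⬝ᵥ v|}) :
    ∃ B : Set (Fin N → Fin m → ℝ), MeasurableSet B ∧
      (Measure.pi fun _ : Fin N => μ).real B ≤ Real.exp (-(β ^ 2 * N / 4)) ∧
      ∀ s ∉ B, ∀ c : Fin m → ℝ, β * N / 8 ≤ hitCount {v | κ * √(c ⬝ᵥ c) ≤ |c ⬝ᵥ v|} s := by
  have hβ1 : β ≤ 1 := (hsmall 0).trans measureReal_le_one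
  have hM1 : (1 : ℝ) ≤ M := by exact_mod_cast hM
  have hN' : (400 : ℝ) ^ 2 * M ≤ N * β ^ 2 := (div_le_iff₀ (by positivity)).1 hN
  have hβN : (400 : ℝ) ^ 2 ≤ β * N := by
    nlinarith [mul_nonneg hβ.le (Nat.cast_nonneg (α := ℝ) N)]
  have hMN : M ≤ N := by
    have : (M : ℝ) ≤ N := by
      nlinarith [mul_nonneg hβ.le (Nat.cast_nonneg (α := ℝ) N), Nat.cast_nonneg (α := ℝ) N]
    exact_mod_cast this
  set r : (Fin m → ℚ) → Fin m → ℝ := Pi.map fun _ q => (q : ℝ)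
  have hr : DenseRange r := DenseRange.piMap fun _ => Rat.denseRange_cast
  set A : (Fin m → ℝ) → Set (Fin m → ℝ) := fun c => {v | κ * √(c ⬝ᵥ c) ≤ |c ⬝ᵥ v|}
  have hA : ∀ c, MeasurableSet (A c) := fun c => by
    refine measurableSet_le measurable_const ?_
    exact Continuous.measurable (by fun_prop)
  refine ⟨{s | ∃ q : Fin m → ℚ, hitCount (A (r q)) s ≤ β * N / 8}, ?_, ?_, ?_⟩
  · rw [Set.ofPred_exists]
    exact MeasurableSet.iUnion fun q =>
      measurableSet_le (measurable_hitCount (hA (r q))) measurable_const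
  · refine (measure_exists_hitCount_le μ (fun q => A (r q)) (fun q => hA (r q))
      (Real.exp (8 * √(N * M))) (Real.exp_pos _).le (fun z 𝒢 h𝒢 => ?_) _ (9 / 10 * (β * N))
      fun q => ?_).trans (two_mul_exp_le_of_sample_size hM hβ hβ1 hN)
    · exact card_slab_traces_le_exp hm hM hMN r (fun q => κ * √(r q ⬝ᵥ r q)) z 𝒢 h𝒢
    · refine (measure_hitCount_lt_le μ N (A (r q)) (hA (r q)) β (hsmall (r q))).trans ?_
      calc Real.exp (-(β * N / 200)) ≤ Real.exp (-1) := Real.exp_le_exp.2 (by linarith)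
        _ ≤ 1 / 2 := by linarith [Real.exp_neg_one_lt_d9]
  · -- membership of a sample point in the slab `|c ⬝ᵥ v| < κ √(c ⬝ᵥ c)` is an open condition on
    -- `c`, so rational `c` suffice
    intro s hs c
    by_contra! hlt
    set O : Set (Fin m → ℝ) := {c' | ∀ i, s i ∉ A c → |c' ⬝ᵥ s i| < κ * √(c' ⬝ᵥ c')}
    have hO : IsOpen O := by
      simp only [O, Set.ofPred_forall]
      refine isOpen_iInter_of_finite fun i => isOpen_iInter_of_finite fun _ => ?_
      exact isOpen_lt (by fun_prop) (by fun_prop)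
    obtain ⟨q, hq⟩ := hr.exists_mem_open hO ⟨c, fun i hi => not_le.1 hi⟩
    refine hs ⟨q, le_trans ?_ hlt.le⟩
    refine Finset.sum_le_sum fun i _ => ?_
    by_cases hi : s i ∈ A c
    · rw [Set.indicator_of_mem (show s i ∈ {v | κ * √(c ⬝ᵥ c) ≤ |c ⬝ᵥ v|} from hi)]
      exact Set.indicator_le_self' (fun _ _ => zero_le_one) _
    · rw [Set.indicator_of_notMem (show s i ∉ A (r q) from not_le.2 (hq i hi))]
      exact Set.indicator_nonneg (fun _ _ => zero_le_one) _

/-! ### The noise term -/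

/-- The second moment of a sum of i.i.d. centred square-integrable variables. -/
theorem integral_sum_sq_of_iid {Ω : Type*} [MeasurableSpace Ω] {P : Measure Ω}
    [IsProbabilityMeasure P] {N : ℕ} {U : Fin N → Ω → ℝ} {V : Ω → ℝ}
    (hindep : iIndepFun U P) (hident : ∀ i, IdentDistrib (U i) V P P) (hV : MemLp V 2 P)
    (hmean : ∫ ω, V ω ∂P = 0) :
    Integrable (fun ω => (∑ i, U i ω) ^ 2) P ∧
      ∫ ω, (∑ i, U i ω) ^ 2 ∂P = N * ∫ ω, V ω ^ 2 ∂P := by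
  have hU : ∀ i, MemLp (U i) 2 P := fun i => (hident i).memLp_iff.2 hV
  have hsum : MemLp (∑ i, U i) 2 P := memLp_finsetSum' _ fun i _ => hU i
  have hmean' : ∫ ω, (∑ i, U i) ω ∂P = 0 := by
    simp only [Finset.sum_apply]
    rw [integral_finsetSum _ fun i _ => (hU i).integrable (by norm_num)]
    exact Finset.sum_eq_zero fun i _ => (hident i).integral_eq.trans hmean
  have hvar := IndepFun.variance_sum (s := Finset.univ) (fun i _ => hU i)
    fun i _ j _ hij => hindep.indepFun hij
  rw [variance_of_integral_eq_zero hsum.aestronglyMeasurable.aemeasurable hmean',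
    Finset.sum_congr rfl fun i _ => (hident i).variance_eq,
    variance_of_integral_eq_zero hV.aestronglyMeasurable.aemeasurable hmean] at hvar
  refine ⟨?_, ?_⟩
  · simpa using hsum.integrable_sq
  · simpa using hvar

/-- The multiplier process `c ↦ ∑ᵢ ξᵢ ⟨c, Zᵢ⟩` is governed by the Euclidean norm of `∑ᵢ ξᵢ Zᵢ`,
whose second moment is at most `N m σ²` for a design with normalized coordinates. -/
theorem integral_noise_sq_le {Ω : Type*} [MeasurableSpace Ω] {P : Measure Ω}
    [IsProbabilityMeasure P] {N m : ℕ} {Z : Fin N → Ω → Fin m → ℝ} {ξ : Fin N → Ω → ℝ}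
    {Z₀ : Ω → Fin m → ℝ} {ξ₀ : Ω → ℝ} {σ : ℝ}
    (hindep : iIndepFun (fun i ω => (Z i ω, ξ i ω)) P)
    (hident : ∀ i, IdentDistrib (fun ω => (Z i ω, ξ i ω)) (fun ω => (Z₀ ω, ξ₀ ω)) P P)
    (hindep₀ : IndepFun Z₀ ξ₀ P) (hZ : ∀ k, MemLp (fun ω => Z₀ ω k) 2 P)
    (hZ1 : ∀ k, ∫ ω, Z₀ ω k ^ 2 ∂P = 1) (hξ : MemLp ξ₀ 2 P) (hξ0 : ∫ ω, ξ₀ ω ∂P = 0)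
    (hσ : ∫ ω, ξ₀ ω ^ 2 ∂P ≤ σ ^ 2) :
    Integrable (fun ω => ∑ k, (∑ i, ξ i ω * Z i ω k) ^ 2) P ∧
      ∫ ω, ∑ k, (∑ i, ξ i ω * Z i ω k) ^ 2 ∂P ≤ N * m * σ ^ 2 := by
  have hg : ∀ k, Measurable fun q : (Fin m → ℝ) × ℝ => q.2 * q.1 k := fun k => by fun_prop
  have hk : ∀ k, Integrable (fun ω => (∑ i, ξ i ω * Z i ω k) ^ 2) P ∧
      ∫ ω, (∑ i, ξ i ω * Z i ω k) ^ 2 ∂P = N * ∫ ω, (ξ₀ ω * Z₀ ω k) ^ 2 ∂P := by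
    intro k
    have hi : IndepFun ξ₀ (fun ω => Z₀ ω k) P :=
      (hindep₀.comp (measurable_pi_apply k) measurable_id).symm
    have hsq : IndepFun (fun ω => ξ₀ ω ^ 2) (fun ω => Z₀ ω k ^ 2) P :=
      hi.comp (measurable_id.pow_const 2) (measurable_id.pow_const 2)
    have hmeas : AEStronglyMeasurable (fun ω => ξ₀ ω * Z₀ ω k) P :=
      hξ.aestronglyMeasurable.mul (hZ k).aestronglyMeasurable
    refine integral_sum_sq_of_iid (hindep.comp _ fun _ => hg k)
      (fun i => (hident i).comp (hg k)) ?_ ?_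
    · rw [memLp_two_iff_integrable_sq hmeas]
      simpa only [mul_pow] using! hsq.integrable_mul hξ.integrable_sq (hZ k).integrable_sq
    · rw [hi.integral_fun_mul_eq_mul_integral hξ.aestronglyMeasurable
        (hZ k).aestronglyMeasurable, hξ0, zero_mul]
  refine ⟨integrable_finsetSum _ fun k _ => (hk k).1, ?_⟩
  rw [integral_finsetSum _ fun k _ => (hk k).1]
  calc ∑ k, ∫ ω, (∑ i, ξ i ω * Z i ω k) ^ 2 ∂P ≤ ∑ _k : Fin m, (N : ℝ) * σ ^ 2 := by
        refine Finset.sum_le_sum fun k _ => ?_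
        rw [(hk k).2]
        have hsq : IndepFun (fun ω => ξ₀ ω ^ 2) (fun ω => Z₀ ω k ^ 2) P :=
          (hindep₀.comp (measurable_pi_apply k) measurable_id).symm.comp
            (measurable_id.pow_const 2) (measurable_id.pow_const 2)
        simp only [mul_pow]
        rw [hsq.integral_fun_mul_eq_mul_integral hξ.integrable_sq.aestronglyMeasurable
          (hZ k).integrable_sq.aestronglyMeasurable, hZ1, mul_one]
        gcongr
    _ = N * m * σ ^ 2 := by
        simp
        ring

/-- Markov's inequality in a form that stays valid when the bound `t` on the mean vanishes. -/
theorem measureReal_mul_lt_le_inv {Ω : Type*} [MeasurableSpace Ω] {P : Measure Ω}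
    [IsProbabilityMeasure P] {W : Ω → ℝ} (hW : Integrable W P) (h0 : ∀ ω, 0 ≤ W ω) {t x : ℝ}
    (ht : ∫ ω, W ω ∂P ≤ t) (hx : 0 < x) : P.real {ω | t * x < W ω} ≤ 1 / x := by
  have ht0 : 0 ≤ t := (integral_nonneg h0).trans ht
  rcases ht0.eq_or_lt with h | h
  · have hz : ∫ ω, W ω ∂P = 0 := le_antisymm (ht.trans h.ge) (integral_nonneg h0)
    have hae := (integral_eq_zero_iff_of_nonneg h0 hW).1 hz
    have : P.real {ω | t * x < W ω} = 0 := by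
      rw [measureReal_eq_zero_iff]
      refine measure_mono_null (fun ω hω => ?_) (ae_iff.1 hae)
      simp only [← h, zero_mul, Set.mem_ofPred_eq] at hω
      exact hω.ne'
    rw [this]
    positivity
  · have h1 := mul_meas_ge_le_integral_of_nonneg (ae_of_all P h0) hW (t * x)
    have h2 : P.real {ω | t * x < W ω} ≤ P.real {ω | t * x ≤ W ω} :=
      measureReal_mono fun ω (hω : t * x < W ω) => hω.le
    rw [le_div_iff₀ hx]
    have h3 := (mul_le_mul_of_nonneg_left h2 (by positivity)).trans (h1.trans ht)
    have h4 : t * (P.real {ω | t * x < W ω} * x) ≤ t * 1 := by linarith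
    exact le_of_mul_le_mul_left h4 h

/-! ### From the two events to the risk bound -/

/-- The deterministic step: if `c` does at least as well as `0` on the sample, then the quadratic
term `∑ᵢ ⟨c, Zᵢ⟩²` is dominated by twice the multiplier term. The former is at least
`κ² |c|² β N / 8` by the hit count, the latter at most `2 |c| √W` by Cauchy–Schwarz. -/
theorem dotProduct_self_le_of_sum_sq_le {m N : ℕ} (z : Fin N → Fin m → ℝ) (ξ : Fin N → ℝ)
    (c : Fin m → ℝ) {κ β w : ℝ} (hκ : 0 < κ) (hβ : 0 < β) (hN : 0 < N)
    (herm : ∑ i, (ξ i - c ⬝ᵥ z i) ^ 2 ≤ ∑ i, ξ i ^ 2)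
    (hhit : β * N / 8 ≤ hitCount {v | κ * √(c ⬝ᵥ c) ≤ |c ⬝ᵥ v|} z)
    (hw : ∑ k, (∑ i, ξ i * z i k) ^ 2 ≤ w) :
    c ⬝ᵥ c ≤ (16 / (β * κ ^ 2)) ^ 2 * (w / N ^ 2) := by
  have hN0 : (0 : ℝ) < N := by exact_mod_cast hN
  have hc0 : 0 ≤ c ⬝ᵥ c := Finset.sum_nonneg fun k _ => mul_self_nonneg _
  set n : ℝ := c ⬝ᵥ c
  have hquad : ∑ i, (c ⬝ᵥ z i) ^ 2 ≤ 2 * ∑ i, ξ i * (c ⬝ᵥ z i) := by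
    have : ∑ i, (ξ i - c ⬝ᵥ z i) ^ 2 =
        ∑ i, ξ i ^ 2 - 2 * ∑ i, ξ i * (c ⬝ᵥ z i) + ∑ i, (c ⬝ᵥ z i) ^ 2 := by
      rw [Finset.mul_sum, ← Finset.sum_sub_distrib, ← Finset.sum_add_distrib]
      exact Finset.sum_congr rfl fun i _ => by ring
    linarith
  have hlow : κ ^ 2 * n * (β * N / 8) ≤ ∑ i, (c ⬝ᵥ z i) ^ 2 := by
    calc κ ^ 2 * n * (β * N / 8)
        ≤ κ ^ 2 * n * hitCount {v | κ * √n ≤ |c ⬝ᵥ v|} z := by gcongr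
      _ ≤ ∑ i, (c ⬝ᵥ z i) ^ 2 := by
        rw [hitCount, Finset.mul_sum]
        refine Finset.sum_le_sum fun i _ => ?_
        by_cases hi : z i ∈ {v | κ * √n ≤ |c ⬝ᵥ v|}
        · rw [Set.indicator_of_mem hi, Pi.one_apply, mul_one, ← sq_abs (c ⬝ᵥ z i),
            ← Real.sq_sqrt hc0, ← mul_pow]
          exact pow_le_pow_left₀ (by positivity) hi 2
        · rw [Set.indicator_of_notMem hi, mul_zero]
          positivity
  have hcs : (∑ i, ξ i * (c ⬝ᵥ z i)) ^ 2 ≤ n * w := by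
    have hswap : ∑ i, ξ i * (c ⬝ᵥ z i) = ∑ k, c k * ∑ i, ξ i * z i k := by
      simp only [dotProduct, Finset.mul_sum]
      rw [Finset.sum_comm]
      exact Finset.sum_congr rfl fun k _ => Finset.sum_congr rfl fun i _ => by ring
    rw [hswap]
    refine (Finset.sum_mul_sq_le_sq_mul_sq _ _ _).trans ?_
    have hn : ∑ k, c k ^ 2 = n := Finset.sum_congr rfl fun k _ => sq _
    rw [hn]
    gcongr
  have hw0 : 0 ≤ w := le_trans (by positivity) hw
  rcases hc0.eq_or_lt with h | h
  · rw [← h]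
    positivity
  · set S := ∑ i, ξ i * (c ⬝ᵥ z i)
    have h1 : κ ^ 2 * n * (β * N) ≤ 16 * S := by linarith
    have h2 : (κ ^ 2 * n * (β * N)) ^ 2 ≤ 16 ^ 2 * (n * w) := by
      calc (κ ^ 2 * n * (β * N)) ^ 2 ≤ (16 * S) ^ 2 := pow_le_pow_left₀ (by positivity) h1 2
        _ = 16 ^ 2 * S ^ 2 := by ring
        _ ≤ _ := by gcongr
    have h3 : n * (n * (β * κ ^ 2 * N) ^ 2) ≤ n * (16 ^ 2 * w) := by
      calc n * (n * (β * κ ^ 2 * N) ^ 2) = (κ ^ 2 * n * (β * N)) ^ 2 := by ring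
        _ ≤ _ := h2
        _ = _ := by ring
    have h4 := le_of_mul_le_mul_left h3 h
    rw [← le_div_iff₀ (by positivity)] at h4
    refine h4.trans_eq ?_
    field_simp

/-! ### Orthonormal coordinates on the dictionary -/

/-- An `L²(ν)`-orthonormal family, of at most `M` measurable functions, with the same span as
`F₁, …, F_M` up to `ν`-null sets. The length `m` is smaller than `M` when the `F j` are linearly
dependent in `L²(ν)`. -/
theorem exists_measurable_orthonormal_family {𝒳 : Type*} [MeasurableSpace 𝒳] (ν : Measure 𝒳)
    {M : ℕ} (F : Fin M → 𝒳 → ℝ) (hF : ∀ j, MemLp (F j) 2 ν) :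
    ∃ (m : ℕ) (e : Fin m → 𝒳 → ℝ) (u : Fin M → Fin m → ℝ) (v : Fin m → Fin M → ℝ), m ≤ M ∧
      (∀ k, Measurable (e k)) ∧ (∀ k, MemLp (e k) 2 ν) ∧
      (∀ k l, ∫ x, e k x * e l x ∂ν = if k = l then 1 else 0) ∧
      (∀ j, F j =ᵐ[ν] fun x => ∑ k, u j k * e k x) ∧
      (∀ k, e k =ᵐ[ν] fun x => ∑ j, v k j * F j x) := by
  set f : Fin M → Lp ℝ 2 ν := fun j => (hF j).toLp (F j)
  set V : Submodule ℝ (Lp ℝ 2 ν) := Submodule.span ℝ (Set.range f)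
  have hVfin : FiniteDimensional ℝ V := FiniteDimensional.span_of_finite ℝ (Set.finite_range f)
  have hm : Module.finrank ℝ V ≤ M := by
    simpa [Set.finrank, V] using finrank_range_le_card (R := ℝ) f
  set b := stdOrthonormalBasis ℝ V
  have hsm : ∀ k, AEStronglyMeasurable ((b k : Lp ℝ 2 ν) : 𝒳 → ℝ) ν := fun k =>
    Lp.aestronglyMeasurable _
  have hfV : ∀ j, f j ∈ V := fun j => Submodule.subset_span ⟨j, rfl⟩
  have hcomb : ∀ {n : ℕ} (a : Fin n → ℝ) (g : Fin n → Lp ℝ 2 ν),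
      ((∑ k, a k • g k : Lp ℝ 2 ν) : 𝒳 → ℝ) =ᵐ[ν] fun x => ∑ k, a k * g k x := by
    intro n a g
    have h2 : ∀ᵐ x ∂ν, ∀ k, (a k • g k : Lp ℝ 2 ν) x = a k * g k x :=
      ae_all_iff.2 fun k => Lp.coeFn_smul (a k) (g k)
    filter_upwards [Lp.coeFn_finsetSum Finset.univ fun k => a k • g k, h2] with x h1 h2
    rw [h1]
    simp [Finset.sum_apply, h2]
  have hev : ∀ k, ∃ w : Fin M → ℝ, ∑ j, w j • f j = (b k : Lp ℝ 2 ν) := fun k =>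
    (Submodule.mem_span_range_iff_exists_fun ℝ).1 (b k).2
  choose v hv using hev
  refine ⟨_, fun k => (hsm k).mk _, fun j k => b.repr ⟨f j, hfV j⟩ k, v, hm,
    fun k => (hsm k).stronglyMeasurable_mk.measurable,
    fun k => (memLp_congr_ae (hsm k).ae_eq_mk).1 (Lp.memLp _), fun k l => ?_, fun j => ?_,
    fun k => ?_⟩
  · have h := orthonormal_iff_ite.1 b.orthonormal l k
    rw [Submodule.coe_inner, L2.inner_def] at h
    rw [show (if k = l then (1 : ℝ) else 0) = if l = k then 1 else 0 by simp [eq_comm], ← h]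
    refine integral_congr_ae ?_
    filter_upwards [(hsm k).ae_eq_mk, (hsm l).ae_eq_mk] with x hx hy
    rw [← hx, ← hy]
    simp
  · have h := congrArg (Subtype.val : V → Lp ℝ 2 ν) (b.sum_repr ⟨f j, hfV j⟩)
    simp only [Submodule.coe_sum, Submodule.coe_smul] at h
    have h2 : ∀ᵐ x ∂ν, ∀ k, ((b k : Lp ℝ 2 ν) : 𝒳 → ℝ) x = (hsm k).mk _ x :=
      ae_all_iff.2 fun k => (hsm k).ae_eq_mk
    have h3 := hcomb (fun k => b.repr ⟨f j, hfV j⟩ k) fun k => (b k : Lp ℝ 2 ν)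
    rw [h] at h3
    filter_upwards [(hF j).coeFn_toLp, h2, h3] with x hx h2 h3
    rw [← hx, h3]
    simp only [h2]
  · have h2 : ∀ᵐ x ∂ν, ∀ j, f j x = F j x := ae_all_iff.2 fun j => (hF j).coeFn_toLp
    have h3 := hcomb (v k) f
    rw [hv k] at h3
    filter_upwards [(hsm k).ae_eq_mk, h2, h3] with x hx h2 h3
    rw [← hx, h3]
    simp only [h2]

/-- In orthonormal coordinates the `L²` norm is the Euclidean norm. -/
theorem integral_dotProduct_sq {𝒳 : Type*} [MeasurableSpace 𝒳] (ν : Measure 𝒳) {m : ℕ}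
    (e : Fin m → 𝒳 → ℝ) (he : ∀ k, MemLp (e k) 2 ν)
    (horth : ∀ k l, ∫ x, e k x * e l x ∂ν = if k = l then 1 else 0) (c : Fin m → ℝ) :
    ∫ x, (c ⬝ᵥ fun k => e k x) ^ 2 ∂ν = c ⬝ᵥ c := by
  have hexp : ∀ x, (c ⬝ᵥ fun k => e k x) ^ 2 = ∑ k, ∑ l, c k * c l * (e k x * e l x) := by
    intro x
    rw [sq, dotProduct, Finset.sum_mul_sum]
    exact Finset.sum_congr rfl fun k _ => Finset.sum_congr rfl fun l _ => by ring
  have hint : ∀ k l, Integrable (fun x => c k * c l * (e k x * e l x)) ν := fun k l =>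
    ((he k).integrable_mul (he l)).const_mul _
  simp_rw [hexp]
  rw [integral_finsetSum _ fun k _ => integrable_finsetSum _ fun l _ => hint k l]
  simp_rw [integral_finsetSum _ fun l _ => hint _ l, integral_const_mul, horth]
  simp [dotProduct]

/-! ### The risk bound for empirical risk minimization -/

theorem mem_dictSpan_iff {𝒳 : Type*} {M : ℕ} {F : Fin M → 𝒳 → ℝ} {f : 𝒳 → ℝ} :
    f ∈ dictSpan F ↔ ∃ a : Fin M → ℝ, ∑ j, a j • F j = f :=
  Submodule.mem_span_range_iff_exists_fun ℝ

theorem designL2Norm_eq_of_ae_eq {Ω 𝒳 : Type*} [MeasurableSpace Ω] [MeasurableSpace 𝒳]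
    {P : Measure Ω} {X : Ω → 𝒳} (hX : AEMeasurable X P) {m : ℕ}
    {e : Fin m → 𝒳 → ℝ} (hem : ∀ k, Measurable (e k)) (he : ∀ k, MemLp (e k) 2 (P.map X))
    (horth : ∀ k l, ∫ x, e k x * e l x ∂(P.map X) = if k = l then 1 else 0)
    {f : 𝒳 → ℝ} {c : Fin m → ℝ} (hf : ∀ᵐ ω ∂P, f (X ω) = c ⬝ᵥ fun k => e k (X ω)) :
    designL2Norm P X f = √(c ⬝ᵥ c) := by
  have hmeas : Measurable fun x => (c ⬝ᵥ fun k => e k x) ^ 2 := by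
    unfold dotProduct
    fun_prop
  rw [designL2Norm, ← integral_dotProduct_sq (P.map X) e he horth c,
    integral_map hX hmeas.aestronglyMeasurable]
  congr 1
  refine integral_congr_ae ?_
  filter_upwards [hf] with ω hω
  rw [hω]

/-- The probability that an i.i.d. sample falls into `B` is the product measure of `B`. -/
theorem measureReal_preimage_of_iid {Ω S : Type*} [MeasurableSpace Ω] [MeasurableSpace S]
    {P : Measure Ω} [IsProbabilityMeasure P] {N : ℕ} {Z : Fin N → Ω → S} {Z₀ : Ω → S}
    (hindep : iIndepFun Z P) (hident : ∀ i, IdentDistrib (Z i) Z₀ P P)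
    {B : Set (Fin N → S)} (hB : MeasurableSet B) :
    P.real {ω | (fun i => Z i ω) ∈ B} = (Measure.pi fun _ : Fin N => P.map Z₀).real B := by
  have hZ : ∀ i, AEMeasurable (Z i) P := fun i => (hident i).aemeasurable_fst
  have h := (iIndepFun_iff_map_fun_eq_pi_map hZ).1 hindep
  simp only [fun i => (hident i).map_eq] at h
  rw [← h, map_measureReal_apply_of_aemeasurable (aemeasurable_pi_lambda _ hZ) hB]
  rfl

theorem mainTheorem2
    {Ω : Type*} [MeasurableSpace Ω] (P : Measure Ω) [IsProbabilityMeasure P]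
    {𝒳 : Type*} [MeasurableSpace 𝒳]
    (M N : ℕ) (F : Fin M → 𝒳 → ℝ) (fstar : 𝒳 → ℝ)
    (X : Ω → 𝒳) (Y ζ : Ω → ℝ)
    (Xs : Fin N → Ω → 𝒳) (Ys : Fin N → Ω → ℝ)
    (κ₀ β₀ σ : ℝ) (hκ₀ : 0 < κ₀) (hβ₀ : 0 < β₀)
    (hX : AEMeasurable X P)
    (hF : ∀ j, MemLp (F j) 2 (P.map X))
    (hfstar : fstar ∈ dictSpan F)
    (hY : ∀ᵐ ω ∂P, Y ω = fstar (X ω) + ζ ω)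
    (hζ : MemLp ζ 2 P)
    (hζ_mean : ∫ ω, ζ ω ∂P = 0)
    (hζ_indep : IndepFun X ζ P)
    (hσ : ∫ ω, (ζ ω) ^ 2 ∂P ≤ σ ^ 2)
    (h_small : SmallBall P X (dictSpan F) κ₀ β₀)
    (h_indep : iIndepFun (fun i ω => (Xs i ω, Ys i ω)) P)
    (h_ident : ∀ i, IdentDistrib (fun ω => (Xs i ω, Ys i ω)) (fun ω => (X ω, Y ω)) P P)
    (hN : (400 : ℝ) ^ 2 * (M : ℝ) / β₀ ^ 2 ≤ (N : ℝ)) :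
    ∀ x : ℝ, 0 < x →
      ∃ E : Set Ω, MeasurableSet E ∧
        1 - Real.exp (-(β₀ ^ 2 * (N : ℝ) / 4)) - 1 / x ≤ P.real E ∧
        ∀ ω ∈ E, ∀ fhat : 𝒳 → ℝ,
          IsERM (dictSpan F) (fun i => Xs i ω) (fun i => Ys i ω) fhat →
            designL2Norm P X (fhat - fstar) ^ 2 ≤
              (16 / (β₀ * κ₀ ^ 2)) ^ 2 * (σ ^ 2 * (M : ℝ) * x / (N : ℝ)) := by
  intro x hx
  rcases Nat.eq_zero_or_pos M with rfl | hM
  · -- an empty dictionary spans only `0`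
    refine ⟨Set.univ, MeasurableSet.univ, ?_, fun ω _ fhat hfhat => ?_⟩
    · have h1 := Real.exp_pos (-(β₀ ^ 2 * (N : ℝ) / 4))
      have h2 : 0 < 1 / x := by positivity
      rw [probReal_univ]
      linarith
    · obtain ⟨a, rfl⟩ := mem_dictSpan_iff.1 hfhat.1
      obtain ⟨a', rfl⟩ := mem_dictSpan_iff.1 hfstar
      simp [designL2Norm]
  have hNpos : 0 < N := by
    have : (0 : ℝ) < N := lt_of_lt_of_le (by positivity) hN
    exact_mod_cast this
  have hN0 : (0 : ℝ) < N := by exact_mod_cast hNpos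
  have : IsProbabilityMeasure (P.map X) := Measure.isProbabilityMeasure_map hX
  obtain ⟨m, e, u, v, hmM, hem, heL, horth, hFe, heF⟩ :=
    exists_measurable_orthonormal_family (P.map X) F hF
  -- `x` is good if the expansion of the dictionary in the orthonormal family holds at `x`
  set good : 𝒳 → Prop := fun x => ∀ j, F j x = ∑ k, u j k * e k x
  have hgood : ∀ᵐ x ∂(P.map X), good x := ae_all_iff.2 hFe
  have hcoord : ∀ (a : Fin M → ℝ) x, good x →
      (∑ j, a j • F j) x = (fun k => ∑ j, a j * u j k) ⬝ᵥ fun k => e k x := by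
    intro a x hg
    simp only [Finset.sum_apply, Pi.smul_apply, smul_eq_mul, dotProduct, hg _, Finset.mul_sum,
      Finset.sum_mul]
    rw [Finset.sum_comm]
    exact Finset.sum_congr rfl fun k _ => Finset.sum_congr rfl fun j _ => by ring
  have hgoodX : ∀ᵐ ω ∂P, good (X ω) := ae_of_ae_map hX hgood
  have hidX : ∀ i, IdentDistrib (Xs i) X P P := fun i => (h_ident i).comp measurable_fst
  have hgoodXs : ∀ᵐ ω ∂P, ∀ i, good (Xs i ω) := by
    refine ae_all_iff.2 fun i => ae_of_ae_map (hidX i).aemeasurable_fst ?_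
    rwa [(hidX i).map_eq]
  obtain ⟨a', ha'⟩ := mem_dictSpan_iff.1 hfstar
  set c' : Fin m → ℝ := fun k => ∑ j, a' j * u j k
  have hstar : ∀ x, good x → fstar x = c' ⬝ᵥ fun k => e k x := fun x hg => by
    rw [← ha', hcoord a' x hg]
  -- the design in orthonormal coordinates, and the noise
  have hev : Measurable fun (x : 𝒳) k => e k x := measurable_pi_lambda _ hem
  have hs : Measurable fun x => c' ⬝ᵥ fun k => e k x := by
    unfold dotProduct
    fun_prop
  set g : 𝒳 × ℝ → (Fin m → ℝ) × ℝ := fun q => (fun k => e k q.1, q.2 - c' ⬝ᵥ fun k => e k q.1)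
  have hg : Measurable g :=
    (hev.comp measurable_fst).prodMk (measurable_snd.sub (hs.comp measurable_fst))
  set Z : Fin N → Ω → Fin m → ℝ := fun i ω k => e k (Xs i ω)
  set ξ : Fin N → Ω → ℝ := fun i ω => Ys i ω - c' ⬝ᵥ fun k => e k (Xs i ω)
  set Z₀ : Ω → Fin m → ℝ := fun ω k => e k (X ω)
  have hZ₀ : AEMeasurable Z₀ P := hev.comp_aemeasurable hX
  have hindep : iIndepFun (fun i ω => (Z i ω, ξ i ω)) P := h_indep.comp _ fun _ => hg
  have hident : ∀ i, IdentDistrib (fun ω => (Z i ω, ξ i ω)) (fun ω => (Z₀ ω, ζ ω)) P P := by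
    intro i
    have h1 : IdentDistrib (fun ω => (Z i ω, ξ i ω)) (fun ω => g (X ω, Y ω)) P P :=
      (h_ident i).comp hg
    refine h1.trans (IdentDistrib.of_ae_eq h1.aemeasurable_snd ?_)
    filter_upwards [hY, hgoodX] with ω h2 h3
    simp only [g, Z₀, h2, hstar _ h3, add_sub_cancel_left]
  -- the two exceptional events
  have hnorm : ∀ (f : 𝒳 → ℝ) (c : Fin m → ℝ),
      (∀ᵐ ω ∂P, f (X ω) = c ⬝ᵥ fun k => e k (X ω)) → designL2Norm P X f = √(c ⬝ᵥ c) :=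
    fun f c => designL2Norm_eq_of_ae_eq hX hem heL horth
  have hprobZ : IsProbabilityMeasure (P.map Z₀) := Measure.isProbabilityMeasure_map hZ₀
  have hsmall : ∀ c : Fin m → ℝ,
      β₀ ≤ (P.map Z₀).real {w | κ₀ * √(c ⬝ᵥ c) ≤ |c ⬝ᵥ w|} := by
    intro c
    set f : 𝒳 → ℝ := ∑ j, (∑ k, c k * v k j) • F j
    have hf : ∀ᵐ ω ∂P, f (X ω) = c ⬝ᵥ fun k => e k (X ω) := by
      filter_upwards [ae_of_ae_map hX (ae_all_iff.2 heF)] with ω hω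
      simp only [f, Finset.sum_apply, Pi.smul_apply, smul_eq_mul, dotProduct, hω,
        Finset.sum_mul, Finset.mul_sum]
      rw [Finset.sum_comm]
      exact Finset.sum_congr rfl fun k _ => Finset.sum_congr rfl fun j _ => by ring
    have hmeas : MeasurableSet {w : Fin m → ℝ | κ₀ * √(c ⬝ᵥ c) ≤ |c ⬝ᵥ w|} :=
      measurableSet_le measurable_const (Continuous.measurable (by fun_prop))
    refine (h_small f (mem_dictSpan_iff.2 ⟨_, rfl⟩)).trans_eq ?_
    rw [map_measureReal_apply_of_aemeasurable hZ₀ hmeas, hnorm f c hf]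
    refine measureReal_congr ?_
    filter_upwards [hf] with ω hω
    refine propext ?_
    change κ₀ * √(c ⬝ᵥ c) ≤ |f (X ω)| ↔ κ₀ * √(c ⬝ᵥ c) ≤ |c ⬝ᵥ fun k => e k (X ω)|
    rw [hω]
  obtain ⟨B, hBm, hBP, hB⟩ :=
    exists_uniform_small_ball_event (N := N) (P.map Z₀) hmM hM hβ₀ hN hsmall
  have hB1 : P.real {ω | (fun i => Z i ω) ∈ B} ≤ Real.exp (-(β₀ ^ 2 * N / 4)) :=
    (measureReal_preimage_of_iid (Z₀ := Z₀)
      (hindep.comp (fun _ => Prod.fst) fun _ => measurable_fst)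
      (fun i => (hident i).comp measurable_fst) hBm).trans_le hBP
  have hnoise := integral_noise_sq_le (σ := σ) hindep hident
    (hζ_indep.comp hev measurable_id) (fun k => (heL k).comp_of_map hX) (fun k => ?_) hζ hζ_mean hσ
  swap
  · have hsq : Measurable fun x => e k x * e k x := (hem k).mul (hem k)
    have := horth k k
    rw [if_pos rfl, integral_map hX hsq.aestronglyMeasurable] at this
    simpa only [Z₀, sq] using this
  have hB2 := measureReal_mul_lt_le_inv hnoise.1
    (fun ω => Finset.sum_nonneg fun k _ => sq_nonneg _) hnoise.2 hx
  have hB3 : P.real {ω | ¬ ∀ i, good (Xs i ω)} = 0 := by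
    rw [measureReal_eq_zero_iff]
    exact ae_iff.1 hgoodXs
  set bad : Set Ω := ({ω | (fun i => Z i ω) ∈ B} ∪
    {ω | N * m * σ ^ 2 * x < ∑ k, (∑ i, ξ i ω * Z i ω k) ^ 2}) ∪ {ω | ¬ ∀ i, good (Xs i ω)}
  have hbad : P.real bad ≤ Real.exp (-(β₀ ^ 2 * N / 4)) + 1 / x := by
    have h1 := measureReal_union_le (μ := P) ({ω | (fun i => Z i ω) ∈ B} ∪
      {ω | N * m * σ ^ 2 * x < ∑ k, (∑ i, ξ i ω * Z i ω k) ^ 2}) {ω | ¬ ∀ i, good (Xs i ω)}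
    have h2 := measureReal_union_le (μ := P) {ω | (fun i => Z i ω) ∈ B}
      {ω | N * m * σ ^ 2 * x < ∑ k, (∑ i, ξ i ω * Z i ω k) ^ 2}
    linarith
  refine ⟨(toMeasurable P bad)ᶜ, (measurableSet_toMeasurable P bad).compl, ?_, ?_⟩
  · rw [probReal_compl_eq_one_sub (measurableSet_toMeasurable P bad), Measure.real,
      measure_toMeasurable]
    have : (P bad).toReal = P.real bad := rfl
    linarith
  intro ω hω fhat hfhat
  have hω' : ω ∉ bad := fun h => hω (subset_toMeasurable P bad h)
  simp only [bad, Set.mem_union, not_or, Set.mem_ofPred_eq, not_lt, not_not] at hω'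
  obtain ⟨⟨hω1, hω2⟩, hω3⟩ := hω'
  obtain ⟨a, ha⟩ := mem_dictSpan_iff.1 hfhat.1
  set c : Fin m → ℝ := (fun k => ∑ j, a j * u j k) - c'
  have hdiff : ∀ x, good x → fhat x - fstar x = c ⬝ᵥ fun k => e k x := fun x hgx => by
    rw [hstar x hgx, ← ha, hcoord a x hgx, ← sub_dotProduct]
  have herm : ∑ i, (ξ i ω - c ⬝ᵥ Z i ω) ^ 2 ≤ ∑ i, ξ i ω ^ 2 := by
    have h1 := hfhat.2 fstar hfstar
    simp only [empiricalRisk] at h1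
    have h2 := le_of_mul_le_mul_left h1 (by positivity)
    refine le_trans (le_of_eq ?_) (h2.trans (le_of_eq ?_))
    · refine Finset.sum_congr rfl fun i _ => ?_
      have h3 : c ⬝ᵥ Z i ω = fhat (Xs i ω) - fstar (Xs i ω) := (hdiff _ (hω3 i)).symm
      simp only [ξ, ← hstar _ (hω3 i), h3]
      ring
    · refine Finset.sum_congr rfl fun i _ => ?_
      simp only [ξ, ← hstar _ (hω3 i)]
  have hfinal := dotProduct_self_le_of_sum_sq_le (fun i => Z i ω) (fun i => ξ i ω) c hκ₀ hβ₀ hNpos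
    herm (hB _ hω1 c) hω2
  have hc0 : 0 ≤ c ⬝ᵥ c := Finset.sum_nonneg fun k _ => mul_self_nonneg _
  rw [hnorm (fhat - fstar) c (hgoodX.mono fun ω h => hdiff _ h), Real.sq_sqrt hc0]
  refine hfinal.trans ?_
  gcongr ?_ * ?_
  calc N * m * σ ^ 2 * x / N ^ 2 ≤ N * M * σ ^ 2 * x / N ^ 2 := by gcongr
    _ = σ ^ 2 * M * x / N := by field_simp
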